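/- **Setting.** Let $X$ be an abstract state space: a real ordered Banach space with closed, generating positive cone $X_+$ on which the norm is additive, $\|u+v\|=\|u\|+\|v\|$ for $u,v\in X_+$. Let $\Psi$ be the linear functional on $X$ with $\langle\Psi,u\rangle=\|u\|$ for $u\in X_+$, and for a linear operator $T$ with domain $D(T)\subseteq X$ write $D(T)_+=D(T)\cap X_+$. A $C_0$-semigroup $(U(t))_{t\ge0}$ on $X$ is substochastic if, for all $t\ge 0$ and $u\in X_+$, $U(t)u\in X_+$ and $\|U(t)u\|\le\|u\|$. Linear operators $A,B$ satisfy the conditions of Kato's theorem if $D(A)\subseteq D(B)$, $A$ generates a substochastic $C_0$-semigroup, $Bu\ge0$ for all $u\in D(A)_+$, and $\langle\Psi,(A+B)u\rangle\le0$ for all $u\in D(A)_+$. The Kato (perturbed) semigroup of $A,B$ is then the substochastic $C_0$-semigroup $(V(t))_{t\ge0}$ whose generator $G$ extends $A+B$ and satisfies $$R(\lambda,G)u=\sum_{k=0}^\infty R(\lambda,A)(BR(\lambda,A))^ku\qquad(\lambda>0,\ u\in X),$$ where $R(\lambda,T)=(\lambda-T)^{-1}$. Put $a(u)=-\langle\Psi,Au+Bu\rangle$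 for $u\in D(A)$, and define $\bar a:D(G)\to\mathbb R$ by $$\bar a(R(\lambda,G)u)=\sum_{k=0}^\infty a\big(R(\lambda,A)(BR(\lambda,A))^ku\big),\qquad u\in X,$$ which does not depend on the choice of $\lambda>0$. The semigroup $(V(t))_{t\ge0}$ is honest if $$\|V(t)u\|-\|u\|=-\bar a\Big(\int_0^tV(s)u\,ds\Big)\qquad\text{for all }t\ge0,\ u\in X_+.$$ **Proposition.** Suppose that $A,B$ satisfy the conditions of Kato's theorem and that their Kato semigroup $(V(t))_{t\ge0}$ is honest. Let $K$ be a linear operator with domain $D(K)\subseteq X$ that is positive, i.e. $Ku\ge0$ for all $u\in D(K)_+$. Let $A_K$ be an extension of the operator $A-K$ with domain $D(A)\cap D(K)$ such that $A_K$ generates a substochastic $C_0$-semigroup and $A_K,B$ also satisfy the conditions of Kato's theorem, with Kato semigroup $(V_K(t))_{t\ge0}$. If $(D(A)\cap D(K))_+$ is dense in $D(A)_+$ with respect to the graph norm $\|u\|+\|Au\|$, then $(V_K(t))_{t\ge0}$ is also honest. -/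

import Mathlib

open Filter Topology
open scoped NNReal

namespace KatoPerturbation

/-- An abstract state space: a real ordered Banach space (the typeclass arguments: a complete real
normed space with a compatible partial order whose positive cone is closed) whose positive cone is
generating and on whose positive cone the norm is additive. -/
class AbstractStateSpace (X : Type*) [NormedAddCommGroup X] [NormedSpace ℝ X] [CompleteSpace X]
    [PartialOrder X] [IsOrderedAddMonoid X] [IsOrderedModule ℝ X] [OrderClosedTopology X] :
    Prop where
  generating : ∀ x : X, ∃ u v : X, 0 ≤ u ∧ 0 ≤ v ∧ x = u - v
  norm_add : ∀ u v : X, 0 ≤ u → 0 ≤ v → ‖u + v‖ = ‖u‖ + ‖v‖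

section Psi

variable {X : Type*} [NormedAddCommGroup X] [NormedSpace ℝ X] [CompleteSpace X]
  [PartialOrder X] [IsOrderedAddMonoid X] [IsOrderedModule ℝ X] [OrderClosedTopology X]
  [AbstractStateSpace X]

/-- `‖u‖ - ‖v‖` depends only on `u - v` for positive `u`, `v`. -/
theorem norm_sub_norm_eq {u v p q : X} (hu : 0 ≤ u) (hv : 0 ≤ v) (hp : 0 ≤ p) (hq : 0 ≤ q)
    (h : u - v = p - q) : ‖u‖ - ‖v‖ = ‖p‖ - ‖q‖ := by
  have h1 : u + q = p + v := sub_eq_sub_iff_add_eq_add.mp h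
  have h2 := AbstractStateSpace.norm_add u q hu hq
  have h3 := AbstractStateSpace.norm_add p v hp hv
  rw [h1] at h2
  linarith

/-- The value of the extension of the norm functional at `x`, via a decomposition of `x` into
positive parts. -/
noncomputable def psiFun (x : X) : ℝ :=
  ‖(AbstractStateSpace.generating x).choose‖ -
    ‖(AbstractStateSpace.generating x).choose_spec.choose‖

theorem psiFun_eq {x u v : X} (hu : 0 ≤ u) (hv : 0 ≤ v) (h : x = u - v) :
    psiFun x = ‖u‖ - ‖v‖ := by
  obtain ⟨h1, h2, h3⟩ := (AbstractStateSpace.generating x).choose_spec.choose_spec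
  exact norm_sub_norm_eq h1 h2 hu hv (h3.symm.trans h)

/-- The linear functional `Ψ` on `X` that extends the norm from the positive cone. -/
noncomputable def Psi : X →ₗ[ℝ] ℝ where
  toFun := psiFun
  map_add' x y := by
    obtain ⟨u, v, hu, hv, hx⟩ := AbstractStateSpace.generating x
    obtain ⟨p, q, hp, hq, hy⟩ := AbstractStateSpace.generating y
    rw [psiFun_eq hu hv hx, psiFun_eq hp hq hy,
      psiFun_eq (add_nonneg hu hp) (add_nonneg hv hq) (by rw [hx, hy]; abel),
      AbstractStateSpace.norm_add u p hu hp, AbstractStateSpace.norm_add v q hv hq]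
    ring
  map_smul' c x := by
    obtain ⟨u, v, hu, hv, hx⟩ := AbstractStateSpace.generating x
    rw [psiFun_eq hu hv hx, RingHom.id_apply, smul_eq_mul]
    rcases le_total 0 c with hc | hc
    · rw [psiFun_eq (smul_nonneg hc hu) (smul_nonneg hc hv) (by rw [hx, smul_sub]),
        norm_smul, norm_smul, Real.norm_of_nonneg hc]
      ring
    · have hc' : 0 ≤ -c := neg_nonneg.mpr hc
      rw [psiFun_eq (smul_nonneg hc' hv) (smul_nonneg hc' hu)
          (by rw [hx, smul_sub, neg_smul, neg_smul]; abel),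
        norm_smul, norm_smul, Real.norm_of_nonneg hc']
      ring

theorem Psi_of_nonneg {u : X} (hu : 0 ≤ u) : Psi u = ‖u‖ := by
  have h : psiFun u = ‖u‖ - ‖(0 : X)‖ := psiFun_eq hu le_rfl (sub_zero u).symm
  exact h.trans (by simp)

end Psi

/-- A `C₀`-semigroup (strongly continuous one-parameter semigroup of bounded operators). -/
structure CZeroSemigroup (X : Type*) [NormedAddCommGroup X] [NormedSpace ℝ X] where
  toFun : ℝ≥0 → X →L[ℝ] X
  at_zero : toFun 0 = 1
  at_add : ∀ s t, toFun (s + t) = toFun s * toFun t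
  tendsto_zero : ∀ x, Tendsto (fun t => toFun t x) (𝓝 0) (𝓝 x)

namespace CZeroSemigroup

variable {X : Type*} [NormedAddCommGroup X] [NormedSpace ℝ X]

/-- `y` is the right derivative at `t = 0` of the orbit of `x`. -/
def HasGenerator (T : CZeroSemigroup X) (x y : X) : Prop :=
  Tendsto (fun t : ℝ≥0 => (t : ℝ)⁻¹ • (T.toFun t x - x)) (𝓝[>] 0) (𝓝 y)

theorem HasGenerator.add {T : CZeroSemigroup X} {x y x' y' : X} (h : T.HasGenerator x y)
    (h' : T.HasGenerator x' y') : T.HasGenerator (x + x') (y + y') := by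
  refine (Tendsto.add h h').congr fun t => ?_
  rw [map_add (T.toFun t), ← smul_add]
  congr 1
  abel

theorem HasGenerator.smul {T : CZeroSemigroup X} {x y : X} (c : ℝ) (h : T.HasGenerator x y) :
    T.HasGenerator (c • x) (c • y) := by
  refine (Tendsto.const_smul h c).congr fun t => ?_
  rw [map_smul, ← smul_sub, smul_comm]

theorem HasGenerator.zero (T : CZeroSemigroup X) : T.HasGenerator 0 0 := by
  simp [HasGenerator]

theorem HasGenerator.unique {T : CZeroSemigroup X} {x y y' : X} (h : T.HasGenerator x y)
    (h' : T.HasGenerator x y') : y = y' :=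
  haveI : (𝓝[>] (0 : ℝ≥0)).NeBot := inferInstance
  tendsto_nhds_unique h h'

/-- The infinitesimal generator of a `C₀`-semigroup, with its natural domain. -/
noncomputable def generator (T : CZeroSemigroup X) : X →ₗ.[ℝ] X where
  domain :=
    { carrier := {x | ∃ y, T.HasGenerator x y}
      add_mem' := fun ⟨y, hy⟩ ⟨y', hy'⟩ => ⟨y + y', hy.add hy'⟩
      zero_mem' := ⟨0, HasGenerator.zero T⟩
      smul_mem' := fun c _ ⟨y, hy⟩ => ⟨c • y, hy.smul c⟩ }
  toFun :=
    { toFun := fun x => x.2.choose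
      map_add' := fun x x' =>
        (x + x').2.choose_spec.unique (x.2.choose_spec.add x'.2.choose_spec)
      map_smul' := fun c x => (c • x).2.choose_spec.unique (x.2.choose_spec.smul c) }

/-- A substochastic semigroup: every `T(t)` is positive, and contractive on the positive cone. -/
def IsSubstochastic [PartialOrder X] (T : CZeroSemigroup X) : Prop :=
  ∀ (t : ℝ≥0) (u : X), 0 ≤ u → 0 ≤ T.toFun t u ∧ ‖T.toFun t u‖ ≤ ‖u‖

end CZeroSemigroup

section Operators

variable {X : Type*} [NormedAddCommGroup X] [NormedSpace ℝ X]

/-- The linear operator `T` evaluated at `u`, for `u ∈ D(T)` (and `0` outside `D(T)`). -/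
noncomputable def app (T : X →ₗ.[ℝ] X) (u : X) : X :=
  open Classical in if h : u ∈ T.domain then T ⟨u, h⟩ else 0

/-- `R` is a bounded two-sided inverse of `lam - A : D(A) → X`. -/
def IsResolvent (A : X →ₗ.[ℝ] X) (lam : ℝ) (R : X →L[ℝ] X) : Prop :=
  (∀ u : X, ∃ h : R u ∈ A.domain, lam • R u - A ⟨R u, h⟩ = u) ∧
    ∀ x : A.domain, R (lam • (x : X) - A x) = x

/-- The resolvent `R(lam, A) = (lam - A)⁻¹`, for `lam` in the resolvent set of `A` (and `0` for
other `lam`). -/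
noncomputable def res (A : X →ₗ.[ℝ] X) (lam : ℝ) : X →L[ℝ] X :=
  open Classical in if h : ∃ R, IsResolvent A lam R then h.choose else 0

/-- The operator `B R(lam, A)`, in the case `D(A) ⊆ D(B)`. -/
noncomputable def bres (A B : X →ₗ.[ℝ] X) (lam : ℝ) (u : X) : X :=
  app B (res A lam u)

/-- `A` generates a substochastic `C₀`-semigroup. -/
def GeneratesSubstochastic [PartialOrder X] (A : X →ₗ.[ℝ] X) : Prop :=
  ∃ U : CZeroSemigroup X, U.IsSubstochastic ∧ U.generator = A

/-- A positive (in general unbounded) operator. -/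
def IsPositiveOp [PartialOrder X] (K : X →ₗ.[ℝ] X) : Prop :=
  ∀ u : K.domain, 0 ≤ (u : X) → 0 ≤ K u

/-- `(D(A) ∩ D(K))_+` is dense in `D(A)_+` with respect to the graph norm of `A`. -/
def PositiveGraphDense [PartialOrder X] (A K : X →ₗ.[ℝ] X) : Prop :=
  ∀ u : A.domain, 0 ≤ (u : X) → ∀ ε : ℝ, 0 < ε →
    ∃ v : A.domain, (v : X) ∈ K.domain ∧ 0 ≤ (v : X) ∧ ‖(u : X) - v‖ + ‖A u - A v‖ < ε

/-- `V` is the perturbed semigroup of Kato's theorem for `A`, `B`: the substochastic `C₀`-semigroup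
whose generator `G` extends `A + B` and satisfies
`R(lam, G) u = ∑ₖ R(lam, A) (B R(lam, A))ᵏ u` for all `lam > 0` and `u ∈ X`. -/
structure IsKatoSemigroup [PartialOrder X] (A B : X →ₗ.[ℝ] X) (V : CZeroSemigroup X) :
    Prop where
  substochastic : V.IsSubstochastic
  extends_add : A + B ≤ V.generator
  hasSum_res : ∀ lam : ℝ, 0 < lam → ∀ u : X,
    HasSum (fun k : ℕ => res A lam ((bres A B lam)^[k] u)) (res V.generator lam u)

end Operators

section Honesty

variable {X : Type*} [NormedAddCommGroup X] [NormedSpace ℝ X] [CompleteSpace X]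
  [PartialOrder X] [IsOrderedAddMonoid X] [IsOrderedModule ℝ X] [OrderClosedTopology X]
  [AbstractStateSpace X]

/-- The hypotheses of Kato's perturbation theorem on an abstract state space. -/
structure KatoConditions (A B : X →ₗ.[ℝ] X) : Prop where
  domain_le : A.domain ≤ B.domain
  generates : GeneratesSubstochastic A
  nonneg : ∀ (u : X) (hu : u ∈ A.domain), 0 ≤ u → 0 ≤ B ⟨u, domain_le hu⟩
  psi_nonpos : ∀ (u : X) (hu : u ∈ A.domain), 0 ≤ u →
    Psi (A ⟨u, hu⟩ + B ⟨u, domain_le hu⟩) ≤ 0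

/-- The functional `a(u) = -⟨Ψ, A u + B u⟩` on `D(A) = D(A + B)`. -/
noncomputable def aFun (A B : X →ₗ.[ℝ] X) (u : X) : ℝ :=
  -Psi (app (A + B) u)

/-- The functional `ā` on `D(G)`, where `G` is the generator of the Kato semigroup:
`ā(R(lam, G) u) = ∑ₖ a(R(lam, A) (B R(lam, A))ᵏ u)`, that is, for `x ∈ D(G)` the right-hand side
with `u = (lam - G) x`. -/
noncomputable def aBar (A B G : X →ₗ.[ℝ] X) (lam : ℝ) (x : G.domain) : ℝ :=
  ∑' k : ℕ, aFun A B (res A lam ((bres A B lam)^[k] (lam • (x : X) - G x)))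

/-- Honesty of the Kato semigroup `V` for `A`, `B`: for all `t ≥ 0` and `u ∈ X_+`, the element
`∫₀ᵗ V(s) u ds` of `D(G)` satisfies `‖V(t) u‖ - ‖u‖ = -ā(∫₀ᵗ V(s) u ds)`. The functional `ā` does
not depend on the auxiliary parameter `lam > 0`, so the identity is required for each of them. -/
def IsHonest (A B : X →ₗ.[ℝ] X) (V : CZeroSemigroup X) : Prop :=
  ∀ lam : ℝ, 0 < lam → ∀ (t : ℝ≥0) (u : X), 0 ≤ u →
    ∃ h : (∫ s in (0 : ℝ)..t, V.toFun s.toNNReal u) ∈ V.generator.domain,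
      ‖V.toFun t u‖ - ‖u‖ =
        -aBar A B V.generator lam ⟨∫ s in (0 : ℝ)..t, V.toFun s.toNNReal u, h⟩

end Honesty

end KatoPerturbation

namespace KatoPerturbation

open MeasureTheory Set

/-! ### Bounded semigroups: orbits, their integrals and Laplace transforms. -/

namespace CZeroSemigroup

variable {X : Type*} [NormedAddCommGroup X] [NormedSpace ℝ X]

/-! Honesty is a statement about iterates. For `P = B R(lam, A)`, `a(R(lam, A) u) = Ψ u - lam
Ψ(R(lam, A) u) - Ψ(P u)`, so the series defining `ā` telescopes and `ā(x) = -Ψ(G x) - c((lam - G)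
x)`, where `c(u) = lim Ψ(Pⁿ u)` is the mass lost (`hasSum_aFun`, `aBar_eq`). Since `G ∫₀ᵗ V(s) u ds
= V(t) u - u`, honesty says that `c` kills `(lam - G) ∫₀ᵗ V(s) u ds`. Dividing by `t` and letting `t
→ 0` gives `c = 0` on the range of `lam - G`, which is all of `X`. Hence honesty means `Pⁿ u → 0`
for `u ≥ 0` (`isHonest_iff`).

This criterion is stable under domination. With `Q = B R(lam, A_K)`, absorption by `K` gives `Q ≤ P`
on the cone (`bres_le_bres_of_sub_le`), so `0 ≤ Qⁿ u ≤ Pⁿ u`, and the norm is monotone on the cone.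
-/

theorem generator_apply_of_hasGenerator {T : CZeroSemigroup X} {x y : X}
    (h : T.HasGenerator x y) :
    ∃ hx : x ∈ T.generator.domain, T.generator ⟨x, hx⟩ = y := by
  have hx : ∃ z, T.HasGenerator x z := ⟨y, h⟩
  exact ⟨hx, hx.choose_spec.unique h⟩

theorem hasGenerator_generator (T : CZeroSemigroup X) (x : T.generator.domain) :
    T.HasGenerator x (T.generator x) :=
  x.2.choose_spec

theorem toFun_add_apply (T : CZeroSemigroup X) (s t : ℝ≥0) (x : X) :
    T.toFun (s + t) x = T.toFun s (T.toFun t x) := by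
  rw [T.at_add]; rfl

theorem toFun_comm_apply (T : CZeroSemigroup X) (s t : ℝ≥0) (x : X) :
    T.toFun s (T.toFun t x) = T.toFun t (T.toFun s x) := by
  rw [← toFun_add_apply, add_comm, toFun_add_apply]

theorem toFun_zero_apply (T : CZeroSemigroup X) (x : X) : T.toFun 0 x = x := by
  rw [T.at_zero]; rfl

theorem tendsto_coe_nhdsGT_zero : Tendsto (fun t : ℝ≥0 => (t : ℝ)) (𝓝[>] 0) (𝓝[>] 0) := by
  refine tendsto_nhdsWithin_of_tendsto_nhds_of_eventually_within _ ?_ ?_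
  · exact (NNReal.continuous_coe.tendsto' 0 0 rfl).mono_left nhdsWithin_le_nhds
  · filter_upwards [self_mem_nhdsWithin] with t ht
    exact NNReal.coe_pos.mpr ht

/-- Turns one-sided limits over `ℝ≥0` into calculus on `ℝ`. -/
theorem hasGenerator_of_hasDerivAt {T : CZeroSemigroup X} {x y : X} {φ : ℝ → X}
    (hφ : HasDerivAt φ y 0) (h0 : φ 0 = 0) (h : ∀ t : ℝ≥0, T.toFun t x - x = φ t) :
    T.HasGenerator x y := by
  have h1 := hφ.tendsto_slope_zero_right
  simp only [zero_add, h0, sub_zero] at h1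
  exact (h1.comp tendsto_coe_nhdsGT_zero).congr fun t => by simp [h t]

section Bounded

variable {T : CZeroSemigroup X} {M : ℝ}

theorem continuous_orbit (hM : ∀ t, ‖T.toFun t‖ ≤ M) (x : X) :
    Continuous fun t : ℝ≥0 => T.toFun t x := by
  have hM0 : 0 ≤ M := (norm_nonneg _).trans (hM 0)
  -- Factoring out the earlier time handles left and right continuity together.
  have key : ∀ s t : ℝ≥0, ‖T.toFun t x - T.toFun s x‖ ≤ M * ‖T.toFun (nndist t s) x - x‖ := by
    have aux : ∀ s t : ℝ≥0, s ≤ t →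
        ‖T.toFun t x - T.toFun s x‖ ≤ M * ‖T.toFun (nndist t s) x - x‖ := by
      intro s t hst
      have h1 : s + nndist t s = t := by
        rw [NNReal.nndist_eq, tsub_eq_zero_of_le hst, max_eq_left zero_le,
          add_tsub_cancel_of_le hst]
      nth_rw 1 [← h1]
      rw [toFun_add_apply, ← map_sub]
      exact (T.toFun s).le_of_opNorm_le (hM s) _
    intro s t
    rcases le_total s t with h | h
    · exact aux s t h
    · rw [norm_sub_rev, nndist_comm]
      exact aux t s h
  rw [continuous_iff_continuousAt]
  intro s
  rw [ContinuousAt, tendsto_iff_norm_sub_tendsto_zero]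
  have h1 : Tendsto (fun t : ℝ≥0 => nndist t s) (𝓝 s) (𝓝 0) :=
    (continuous_id.nndist continuous_const).tendsto' s 0 (by simp)
  have h2 : Tendsto (fun t : ℝ≥0 => M * ‖T.toFun (nndist t s) x - x‖) (𝓝 s) (𝓝 0) := by
    have := (((T.tendsto_zero x).comp h1).sub_const x).norm.const_mul M
    simpa using this
  exact squeeze_zero (fun _ => norm_nonneg _) (fun t => key s t) h2

theorem continuous_orbit_toNNReal (hM : ∀ t, ‖T.toFun t‖ ≤ M) (x : X) :
    Continuous fun t : ℝ => T.toFun t.toNNReal x :=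
  (continuous_orbit hM x).comp continuous_real_toNNReal

theorem integrableOn_laplace (hM : ∀ t, ‖T.toFun t‖ ≤ M) {lam : ℝ} (hlam : 0 < lam) (x : X) :
    IntegrableOn (fun t : ℝ => Real.exp (-lam * t) • T.toFun t.toNNReal x) (Ioi 0) := by
  have hc : Continuous fun t : ℝ => Real.exp (-lam * t) • T.toFun t.toNNReal x :=
    (by fun_prop : Continuous fun t : ℝ => Real.exp (-lam * t)).smul
      (continuous_orbit_toNNReal hM x)
  have h1 : IntegrableOn (fun t : ℝ => Real.exp (-lam * t) * (M * ‖x‖)) (Ioi 0) :=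
    (integrableOn_exp_mul_Ioi (neg_lt_zero.mpr hlam) 0).mul_const _
  refine h1.mono' hc.aestronglyMeasurable (Eventually.of_forall fun t => ?_)
  rw [norm_smul, Real.norm_of_nonneg (Real.exp_pos _).le]
  exact mul_le_mul_of_nonneg_left ((T.toFun _).le_of_opNorm_le (hM _) _) (Real.exp_pos _).le

theorem exists_laplace (hM : ∀ t, ‖T.toFun t‖ ≤ M) {lam : ℝ} (hlam : 0 < lam) :
    ∃ R : X →L[ℝ] X, ∀ x, R x =
      ∫ t in Ioi (0 : ℝ), Real.exp (-lam * t) • T.toFun t.toNNReal x := by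
  refine ⟨LinearMap.mkContinuous
    { toFun := fun x => ∫ t in Ioi (0 : ℝ), Real.exp (-lam * t) • T.toFun t.toNNReal x
      map_add' := fun x y => ?_
      map_smul' := fun c x => ?_ }
    ((∫ t in Ioi (0 : ℝ), Real.exp (-lam * t)) * M) fun x => ?_, fun x => rfl⟩
  · rw [← integral_add (integrableOn_laplace hM hlam x) (integrableOn_laplace hM hlam y)]
    simp only [map_add, smul_add]
  · rw [RingHom.id_apply, ← integral_smul]
    simp only [map_smul, smul_comm c]
  · have h1 : IntegrableOn (fun t : ℝ => Real.exp (-lam * t) * (M * ‖x‖)) (Ioi 0) :=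
      (integrableOn_exp_mul_Ioi (neg_lt_zero.mpr hlam) 0).mul_const _
    have h2 := norm_integral_le_of_norm_le (μ := volume.restrict (Ioi (0 : ℝ))) h1
      (f := fun t : ℝ => Real.exp (-lam * t) • T.toFun t.toNNReal x)
      (Eventually.of_forall fun t => by
        rw [norm_smul, Real.norm_of_nonneg (Real.exp_pos _).le]
        exact mul_le_mul_of_nonneg_left ((T.toFun _).le_of_opNorm_le (hM _) _)
          (Real.exp_pos _).le)
    rwa [integral_mul_const, ← mul_assoc] at h2

variable [CompleteSpace X]

theorem hasDerivAt_integral_orbit_zero (hM : ∀ t, ‖T.toFun t‖ ≤ M) (x : X) :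
    HasDerivAt (fun t : ℝ => ∫ s in (0 : ℝ)..t, T.toFun s.toNNReal x) x 0 := by
  have hc := continuous_orbit_toNNReal hM x
  have := hc.integral_hasStrictDerivAt 0 0
  simpa [toFun_zero_apply] using this.hasDerivAt

/-- The integral of an orbit lies in the domain of the generator. -/
theorem hasGenerator_integral_orbit (hM : ∀ t, ‖T.toFun t‖ ≤ M) (x : X) (t : ℝ≥0) :
    T.HasGenerator (∫ s in (0 : ℝ)..t, T.toFun s.toNNReal x) (T.toFun t x - x) := by
  set g : ℝ → X := fun s => T.toFun s.toNNReal x with hg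
  have hc : Continuous g := continuous_orbit_toNNReal hM x
  have hint : ∀ a b, IntervalIntegrable g volume a b := fun a b => hc.intervalIntegrable a b
  -- `T(h)` shifts the window of integration from `[0, t]` to `[h, h + t]`.
  refine hasGenerator_of_hasDerivAt
    (φ := fun h => (∫ s in (0 : ℝ)..(h + t), g s) - (∫ s in (0 : ℝ)..h, g s) -
      ∫ s in (0 : ℝ)..t, g s) ?_ (by simp) ?_
  · have h1 : HasDerivAt (fun h : ℝ => ∫ s in (0 : ℝ)..(h + t), g s) (g t) 0 := by
      have : HasDerivAt (fun h : ℝ => ∫ s in (0 : ℝ)..h, g s) (g (0 + t)) (0 + (t : ℝ)) :=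
        (hc.integral_hasStrictDerivAt 0 _).hasDerivAt
      simpa using this.comp_add_const 0 (t : ℝ)
    have h2 := hasDerivAt_integral_orbit_zero hM x
    have h3 := (h1.sub h2).sub_const (∫ s in (0 : ℝ)..t, g s)
    simpa [hg] using h3
  · intro h
    have h1 : T.toFun h (∫ s in (0 : ℝ)..t, g s) = ∫ s in (0 : ℝ)..t, g (s + h) := by
      rw [← ContinuousLinearMap.intervalIntegral_comp_comm _ (hint _ _)]
      refine intervalIntegral.integral_congr fun s hs => ?_
      rw [uIcc_of_le t.coe_nonneg] at hs
      simp only [hg]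
      rw [← toFun_add_apply, Real.toNNReal_add hs.1 h.coe_nonneg, Real.toNNReal_coe, add_comm]
    rw [h1, intervalIntegral.integral_comp_add_right, zero_add, add_comm (t : ℝ) h,
      ← intervalIntegral.integral_interval_sub_left (hint 0 _) (hint 0 h)]

theorem integral_orbit_mem_domain (hM : ∀ t, ‖T.toFun t‖ ≤ M) (x : X) (t : ℝ≥0) :
    ∃ h : (∫ s in (0 : ℝ)..t, T.toFun s.toNNReal x) ∈ T.generator.domain,
      T.generator ⟨_, h⟩ = T.toFun t x - x :=
  generator_apply_of_hasGenerator (hasGenerator_integral_orbit hM x t)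

theorem hasGenerator_laplace (hM : ∀ t, ‖T.toFun t‖ ≤ M) {lam : ℝ} (hlam : 0 < lam) (x : X) :
    T.HasGenerator (∫ t in Ioi (0 : ℝ), Real.exp (-lam * t) • T.toFun t.toNNReal x)
      (lam • (∫ t in Ioi (0 : ℝ), Real.exp (-lam * t) • T.toFun t.toNNReal x) - x) := by
  set g : ℝ → X := fun t => Real.exp (-lam * t) • T.toFun t.toNNReal x with hg
  have hc : Continuous g :=
    (by fun_prop : Continuous fun t : ℝ => Real.exp (-lam * t)).smul
      (continuous_orbit_toNNReal hM x)
  have hint : IntegrableOn g (Ioi 0) := integrableOn_laplace hM hlam x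
  set r := ∫ t in Ioi (0 : ℝ), g t with hr
  -- Here `T(h) r = exp(lam h) ∫ₕ^∞ g`; the product rule at `h = 0` gives `lam r - x`.
  refine hasGenerator_of_hasDerivAt
    (φ := fun h => Real.exp (lam * h) • (r - ∫ s in (0 : ℝ)..h, g s) - r) ?_ (by simp) ?_
  · have h1 : HasDerivAt (fun h : ℝ => ∫ s in (0 : ℝ)..h, g s) x 0 := by
      simpa [hg, toFun_zero_apply] using (hc.integral_hasStrictDerivAt 0 0).hasDerivAt
    have h2 : HasDerivAt (fun h : ℝ => Real.exp (lam * h)) lam 0 := by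
      simpa using ((hasDerivAt_id (0 : ℝ)).const_mul lam).exp
    have h3 := (h2.smul (h1.const_sub r)).sub_const r
    refine h3.congr_deriv ?_
    simp [sub_eq_neg_add]
  · intro h
    have h1 : T.toFun h r = ∫ t in Ioi (0 : ℝ), Real.exp (lam * h) • g (t + h) := by
      rw [hr, ← ContinuousLinearMap.integral_comp_comm _ hint]
      refine setIntegral_congr_fun measurableSet_Ioi fun s hs => ?_
      simp only [hg]
      rw [map_smul, ← toFun_add_apply, Real.toNNReal_add (le_of_lt hs) h.coe_nonneg, Real.toNNReal_coe,
        add_comm h, smul_smul, ← Real.exp_add]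
      congr 2
      ring
    have h2 : ∫ t in Ioi (0 : ℝ), g (t + h) = ∫ t in Ioi (h : ℝ), g t := by
      have := (measurePreserving_add_right volume (h : ℝ)).setIntegral_preimage_emb
        (MeasurableEquiv.addRight (h : ℝ)).measurableEmbedding g (Ioi (h : ℝ))
      simpa using this
    have h3 : r = (∫ s in (0 : ℝ)..h, g s) + ∫ t in Ioi (h : ℝ), g t := by
      rw [hr, intervalIntegral.integral_of_le h.coe_nonneg,
        ← setIntegral_union Ioc_disjoint_Ioi_same measurableSet_Ioi
          (hint.mono_set Ioc_subset_Ioi_self) (hint.mono_set (Ioi_subset_Ioi h.coe_nonneg)),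
        Ioc_union_Ioi_eq_Ioi h.coe_nonneg]
    rw [h1, integral_smul, h2, h3, add_sub_cancel_left]

/-- The Laplace transform of a bounded semigroup is the resolvent of its generator. -/
theorem isResolvent_of_laplace (hM : ∀ t, ‖T.toFun t‖ ≤ M) {lam : ℝ} (hlam : 0 < lam)
    {R : X →L[ℝ] X}
    (hR : ∀ x, R x = ∫ t in Ioi (0 : ℝ), Real.exp (-lam * t) • T.toFun t.toNNReal x) :
    IsResolvent T.generator lam R := by
  have hgen : ∀ x, T.HasGenerator (R x) (lam • R x - x) := fun x => by
    rw [hR]; exact hasGenerator_laplace hM hlam x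
  refine ⟨fun x => ?_, fun x => ?_⟩
  · obtain ⟨h, h'⟩ := generator_apply_of_hasGenerator (hgen x)
    exact ⟨h, by rw [h']; abel⟩
  -- `R` commutes with the semigroup, so it carries difference quotients at `x` to those at `R x`;
  -- hence `R (G x) = G (R x) = lam R x - x`.
  · have hcomm : ∀ (t : ℝ≥0) (y : X), R (T.toFun t y) = T.toFun t (R y) := fun t y => by
      rw [hR, hR, ← ContinuousLinearMap.integral_comp_comm _ (integrableOn_laplace hM hlam y)]
      refine integral_congr_ae (Eventually.of_forall fun s => ?_)
      simp only [map_smul]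
      rw [toFun_comm_apply]
    have h1 : Tendsto (fun t : ℝ≥0 => (t : ℝ)⁻¹ • (T.toFun t (R x) - R x)) (𝓝[>] 0)
        (𝓝 (R (T.generator x))) := by
      refine ((R.continuous.tendsto _).comp (T.hasGenerator_generator x)).congr fun t => ?_
      simp only [Function.comp_apply, map_smul, map_sub, hcomm]
    have h2 := HasGenerator.unique h1 (hgen x)
    rw [map_sub, map_smul, h2]
    abel

end Bounded

end CZeroSemigroup

/-! ### Uniqueness and injectivity of resolvents. -/

section Resolvent

variable {X : Type*} [NormedAddCommGroup X] [NormedSpace ℝ X]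

theorem IsResolvent.unique {A : X →ₗ.[ℝ] X} {lam : ℝ} {R S : X →L[ℝ] X}
    (hR : IsResolvent A lam R) (hS : IsResolvent A lam S) : R = S := by
  ext u
  obtain ⟨h, h'⟩ := hR.1 u
  have := hS.2 ⟨R u, h⟩
  rw [h'] at this
  exact this.symm

theorem IsResolvent.res_eq {A : X →ₗ.[ℝ] X} {lam : ℝ} {R : X →L[ℝ] X}
    (hR : IsResolvent A lam R) : res A lam = R := by
  have h : ∃ R, IsResolvent A lam R := ⟨R, hR⟩
  rw [res, dif_pos h]
  exact h.choose_spec.unique hR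

theorem app_of_mem {T : X →ₗ.[ℝ] X} {u : X} (h : u ∈ T.domain) : app T u = T ⟨u, h⟩ :=
  dif_pos h

theorem IsResolvent.injective {A : X →ₗ.[ℝ] X} {lam : ℝ} {R : X →L[ℝ] X}
    (hR : IsResolvent A lam R) : Function.Injective R := by
  intro u v huv
  obtain ⟨h, h1⟩ := hR.1 u
  obtain ⟨h', h2⟩ := hR.1 v
  rw [← h1, ← h2]
  simp only [huv]

theorem add_apply_of_mem {A B : X →ₗ.[ℝ] X} {x : X} (hA : x ∈ A.domain) (hB : x ∈ B.domain) :
    ∃ h : x ∈ (A + B).domain, (A + B) ⟨x, h⟩ = A ⟨x, hA⟩ + B ⟨x, hB⟩ :=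
  ⟨⟨hA, hB⟩, rfl⟩

end Resolvent

/-! ### Resolvents of substochastic semigroups. -/

section Substochastic

variable {X : Type*} [NormedAddCommGroup X] [NormedSpace ℝ X] [CompleteSpace X]
  [PartialOrder X] [IsOrderedAddMonoid X] [IsOrderedModule ℝ X] [OrderClosedTopology X]
  [AbstractStateSpace X]

/-- Contractivity is assumed on the cone only; as the cone is generating, orbits are bounded and the
uniform boundedness principle applies. -/
theorem CZeroSemigroup.IsSubstochastic.exists_bound {T : CZeroSemigroup X}
    (hT : T.IsSubstochastic) : ∃ M, ∀ t, ‖T.toFun t‖ ≤ M := by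
  refine banach_steinhaus fun x => ?_
  obtain ⟨u, v, hu, hv, rfl⟩ := AbstractStateSpace.generating x
  refine ⟨‖u‖ + ‖v‖, fun t => ?_⟩
  rw [map_sub]
  exact (norm_sub_le _ _).trans (add_le_add (hT t u hu).2 (hT t v hv).2)

theorem CZeroSemigroup.IsSubstochastic.isResolvent_res {T : CZeroSemigroup X}
    (hT : T.IsSubstochastic) {lam : ℝ} (hlam : 0 < lam) :
    IsResolvent T.generator lam (res T.generator lam) ∧
      ∀ u, 0 ≤ u → 0 ≤ res T.generator lam u := by
  obtain ⟨M, hM⟩ := hT.exists_bound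
  obtain ⟨R, hR⟩ := CZeroSemigroup.exists_laplace hM hlam
  have h := CZeroSemigroup.isResolvent_of_laplace hM hlam hR
  rw [h.res_eq]
  refine ⟨h, fun u hu => ?_⟩
  rw [hR]
  exact integral_nonneg fun t => smul_nonneg (Real.exp_pos _).le (hT _ u hu).1

theorem GeneratesSubstochastic.isResolvent_res {A : X →ₗ.[ℝ] X}
    (hA : GeneratesSubstochastic A) {lam : ℝ} (hlam : 0 < lam) :
    IsResolvent A lam (res A lam) ∧ ∀ u, 0 ≤ u → 0 ≤ res A lam u := by
  obtain ⟨U, hU, rfl⟩ := hA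
  exact hU.isResolvent_res hlam

end Substochastic

end KatoPerturbation

namespace KatoPerturbation

/-! ### The defect functional, the honesty criterion and domination. -/

section Kato

variable {X : Type*} [NormedAddCommGroup X] [NormedSpace ℝ X] [CompleteSpace X]
  [PartialOrder X] [IsOrderedAddMonoid X] [IsOrderedModule ℝ X] [OrderClosedTopology X]
  [AbstractStateSpace X]

theorem abs_Psi_le (x : X) : |Psi x| ≤ ‖x‖ := by
  obtain ⟨u, v, hu, hv, rfl⟩ := AbstractStateSpace.generating x
  rw [map_sub, Psi_of_nonneg hu, Psi_of_nonneg hv]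
  exact abs_norm_sub_norm_le u v

/-- The functional `Ψ` as a continuous linear functional. -/
noncomputable def PsiL (X : Type*) [NormedAddCommGroup X] [NormedSpace ℝ X] [CompleteSpace X]
    [PartialOrder X] [IsOrderedAddMonoid X] [IsOrderedModule ℝ X] [OrderClosedTopology X]
    [AbstractStateSpace X] : X →L[ℝ] ℝ :=
  Psi.mkContinuous 1 fun x => by simpa using abs_Psi_le x

theorem norm_mono_of_nonneg {u v : X} (hu : 0 ≤ u) (huv : u ≤ v) : ‖u‖ ≤ ‖v‖ := by
  have h := AbstractStateSpace.norm_add u (v - u) hu (sub_nonneg.mpr huv)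
  rw [add_sub_cancel] at h
  rw [h]
  exact le_add_of_nonneg_right (norm_nonneg _)

namespace KatoConditions

variable {A B : X →ₗ.[ℝ] X} {V : CZeroSemigroup X} {lam : ℝ}

theorem isResolvent_res (h : KatoConditions A B) (hlam : 0 < lam) :
    IsResolvent A lam (res A lam) :=
  (h.generates.isResolvent_res hlam).1

theorem res_nonneg (h : KatoConditions A B) (hlam : 0 < lam) {u : X} (hu : 0 ≤ u) :
    0 ≤ res A lam u :=
  (h.generates.isResolvent_res hlam).2 u hu

theorem res_mem (h : KatoConditions A B) (hlam : 0 < lam) (u : X) :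
    res A lam u ∈ A.domain :=
  ((h.isResolvent_res hlam).1 u).1

theorem apply_res (h : KatoConditions A B) (hlam : 0 < lam) (u : X) :
    A ⟨res A lam u, h.res_mem hlam u⟩ = lam • res A lam u - u := by
  obtain ⟨_, h'⟩ := (h.isResolvent_res hlam).1 u
  exact eq_sub_iff_add_eq.mpr (add_comm (A _) u ▸ (sub_eq_iff_eq_add.mp h').symm)

theorem bres_eq (h : KatoConditions A B) (hlam : 0 < lam) (u : X) :
    bres A B lam u = B ⟨res A lam u, h.domain_le (h.res_mem hlam u)⟩ :=
  app_of_mem _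

theorem bres_nonneg (h : KatoConditions A B) (hlam : 0 < lam) {u : X} (hu : 0 ≤ u) :
    0 ≤ bres A B lam u := by
  rw [h.bres_eq hlam]
  exact h.nonneg _ (h.res_mem hlam u) (h.res_nonneg hlam hu)

theorem app_add_res (h : KatoConditions A B) (hlam : 0 < lam) (u : X) :
    app (A + B) (res A lam u) = lam • res A lam u - u + bres A B lam u := by
  obtain ⟨hm, h'⟩ := add_apply_of_mem (h.res_mem hlam u) (h.domain_le (h.res_mem hlam u))
  rw [app_of_mem hm, h', h.apply_res hlam, h.bres_eq hlam]

theorem aFun_res (h : KatoConditions A B) (hlam : 0 < lam) (u : X) :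
    aFun A B (res A lam u) =
      Psi u - lam * Psi (res A lam u) - Psi (bres A B lam u) := by
  rw [aFun, h.app_add_res hlam, map_add, map_sub, map_smul, smul_eq_mul]
  ring

theorem aFun_res_nonneg (h : KatoConditions A B) (hlam : 0 < lam) {u : X} (hu : 0 ≤ u) :
    0 ≤ aFun A B (res A lam u) := by
  have hA := h.res_mem hlam u
  obtain ⟨hm, h'⟩ := add_apply_of_mem hA (h.domain_le hA)
  rw [aFun, app_of_mem hm, h', neg_nonneg]
  exact h.psi_nonpos _ hA (h.res_nonneg hlam hu)

theorem Psi_bres_le (h : KatoConditions A B) (hlam : 0 < lam) {u : X} (hu : 0 ≤ u) :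
    Psi (bres A B lam u) ≤ Psi u := by
  have h1 := h.aFun_res_nonneg hlam hu
  have h2 : 0 ≤ Psi (res A lam u) := by
    rw [Psi_of_nonneg (h.res_nonneg hlam hu)]; exact norm_nonneg _
  rw [h.aFun_res hlam] at h1
  nlinarith [mul_nonneg hlam.le h2]

/-- As `G` extends `A + B`, applying `lam - G` to `R(lam, A) u` gives `u - B R(lam, A) u`. -/
theorem res_generator_sub_bres (h : KatoConditions A B) (hV : IsKatoSemigroup A B V)
    (hlam : 0 < lam) (u : X) :
    res V.generator lam (u - bres A B lam u) = res A lam u := by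
  have hA := h.res_mem hlam u
  obtain ⟨hm, -⟩ := add_apply_of_mem hA (h.domain_le hA)
  have hG : res A lam u ∈ V.generator.domain := hV.extends_add.1 hm
  have h1 : V.generator ⟨_, hG⟩ = lam • res A lam u - u + bres A B lam u := by
    rw [← h.app_add_res hlam, app_of_mem hm]
    exact (hV.extends_add.2 rfl).symm
  have h2 := (hV.substochastic.isResolvent_res hlam).1.2 ⟨_, hG⟩
  rw [h1] at h2
  refine Eq.trans ?_ h2
  congr 1
  simp only
  abel

/-- The operator `B R(lam, A)` is bounded. -/
theorem exists_bres_eq (h : KatoConditions A B) (hV : IsKatoSemigroup A B V)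
    (hlam : 0 < lam) : ∃ P : X →L[ℝ] X, ⇑P = bres A B lam := by
  let L : X →ₗ[ℝ] X := B.toFun ∘ₗ
    (res A lam : X →ₗ[ℝ] X).codRestrict B.domain fun u => h.domain_le (h.res_mem hlam u)
  have hL : ⇑L = bres A B lam := funext fun u => (h.bres_eq hlam u).symm
  refine ⟨⟨L, ?_⟩, hL⟩
  -- Closed graph theorem: if `u n → x` and `L (u n) → y`, then `R(lam, G)` takes the same value at
  -- `x - y` and `x - L x`, and it is injective.
  refine L.continuous_of_seq_closed_graph fun u x y hu hy => ?_
  have hG := (hV.substochastic.isResolvent_res hlam).1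
  have h1 : Tendsto (fun n => res V.generator lam (u n - L (u n))) atTop
      (𝓝 (res V.generator lam (x - y))) :=
    ((res V.generator lam).continuous.tendsto _).comp (hu.sub hy)
  have h2 : Tendsto (fun n => res V.generator lam (u n - L (u n))) atTop
      (𝓝 (res V.generator lam (x - L x))) := by
    simp only [hL, h.res_generator_sub_bres hV hlam]
    exact ((res A lam).continuous.tendsto _).comp hu
  exact sub_right_injective (hG.injective (tendsto_nhds_unique h1 h2))

theorem iterate_bres_nonneg (h : KatoConditions A B) (hlam : 0 < lam) {u : X} (hu : 0 ≤ u)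
    (n : ℕ) : 0 ≤ (bres A B lam)^[n] u := by
  induction n with
  | zero => exact hu
  | succ n ih =>
    rw [Function.iterate_succ_apply']
    exact h.bres_nonneg hlam ih

theorem iterate_bres_sub (h : KatoConditions A B) (hV : IsKatoSemigroup A B V)
    (hlam : 0 < lam) (n : ℕ) (u v : X) :
    (bres A B lam)^[n] (u - v) = (bres A B lam)^[n] u - (bres A B lam)^[n] v := by
  obtain ⟨P, hP⟩ := h.exists_bres_eq hV hlam
  rw [← hP]
  exact iterate_map_sub P n u v

theorem bres_sub (h : KatoConditions A B) (hV : IsKatoSemigroup A B V) (hlam : 0 < lam)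
    (u v : X) : bres A B lam (u - v) = bres A B lam u - bres A B lam v :=
  h.iterate_bres_sub hV hlam 1 u v

/-- The limit functional `u ↦ lim Ψ((B R(lam, A))ⁿ u)` exists and is continuous. -/
theorem exists_defect (h : KatoConditions A B) (hV : IsKatoSemigroup A B V)
    (hlam : 0 < lam) : ∃ c : X →L[ℝ] ℝ, ∀ u,
      Tendsto (fun n => Psi ((bres A B lam)^[n] u)) atTop (𝓝 (c u)) := by
  have hpos : ∀ u, 0 ≤ u → ∃ l,
      Tendsto (fun n => Psi ((bres A B lam)^[n] u)) atTop (𝓝 l) := by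
    intro u hu
    -- On the cone `B R(lam, A)` does not increase `Ψ`, so the sequence decreases and is bounded
    -- below by zero.
    refine ⟨_, tendsto_atTop_ciInf (antitone_nat_of_succ_le fun n => ?_) ⟨0, ?_⟩⟩
    · rw [Function.iterate_succ_apply']
      exact h.Psi_bres_le hlam (h.iterate_bres_nonneg hlam hu n)
    · rintro _ ⟨n, rfl⟩
      simp only [Psi_of_nonneg (h.iterate_bres_nonneg hlam hu n)]
      exact norm_nonneg _
  have hall : ∀ u, ∃ l, Tendsto (fun n => Psi ((bres A B lam)^[n] u)) atTop (𝓝 l) := by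
    intro x
    obtain ⟨u, v, hu, hv, rfl⟩ := AbstractStateSpace.generating x
    obtain ⟨l, hl⟩ := hpos u hu
    obtain ⟨m, hm⟩ := hpos v hv
    refine ⟨l - m, (hl.sub hm).congr fun n => ?_⟩
    rw [h.iterate_bres_sub hV hlam, map_sub]
  choose c hc using hall
  obtain ⟨P, hP⟩ := h.exists_bres_eq hV hlam
  have hlim : Tendsto (fun n x => ((PsiL X).comp (P ^ n)) x) atTop (𝓝 c) := by
    rw [tendsto_pi_nhds]
    intro x
    refine (hc x).congr fun n => ?_
    have hpow : (P ^ n) x = P^[n] x := congrFun (hom_coe_pow _ rfl (fun _ _ => rfl) P n) x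
    rw [← hP, ContinuousLinearMap.comp_apply, hpow]
    rfl
  exact ⟨continuousLinearMapOfTendsto _ hlim, hc⟩

theorem hasSum_aFun (h : KatoConditions A B) (hV : IsKatoSemigroup A B V) (hlam : 0 < lam)
    {c : X →L[ℝ] ℝ}
    (hc : ∀ u, Tendsto (fun n => Psi ((bres A B lam)^[n] u)) atTop (𝓝 (c u))) (u : X) :
    HasSum (fun k : ℕ => aFun A B (res A lam ((bres A B lam)^[k] u)))
      (Psi u - lam * Psi (res V.generator lam u) - c u) := by
  have hpos : ∀ u, 0 ≤ u → HasSum (fun k : ℕ => aFun A B (res A lam ((bres A B lam)^[k] u)))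
      (Psi u - lam * Psi (res V.generator lam u) - c u) := by
    intro u hu
    -- Nonnegative terms reduce unconditional summability to convergence of the telescoping partial
    -- sums; this is why positive vectors come first.
    rw [hasSum_iff_tendsto_nat_of_nonneg fun k =>
      h.aFun_res_nonneg hlam (h.iterate_bres_nonneg hlam hu k)]
    have h1 : ∀ n : ℕ, ∑ k ∈ Finset.range n, aFun A B (res A lam ((bres A B lam)^[k] u)) =
        Psi u - lam * Psi (∑ k ∈ Finset.range n, res A lam ((bres A B lam)^[k] u)) -
          Psi ((bres A B lam)^[n] u) := by
      intro n
      induction n with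
      | zero => simp
      | succ n ih =>
        rw [Finset.sum_range_succ, Finset.sum_range_succ, ih, h.aFun_res hlam, map_add,
          Function.iterate_succ_apply']
        ring
    simp only [h1]
    have h2 := ((PsiL X).continuous.tendsto _).comp (hV.hasSum_res lam hlam u).tendsto_sum_nat
    exact ((h2.const_mul lam).const_sub (Psi u)).sub (hc u)
  obtain ⟨p, q, hp, hq, rfl⟩ := AbstractStateSpace.generating u
  have hsub := (hpos p hp).sub (hpos q hq)
  have hval : Psi p - lam * Psi (res V.generator lam p) - c p -
      (Psi q - lam * Psi (res V.generator lam q) - c q) =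
      Psi (p - q) - lam * Psi (res V.generator lam (p - q)) - c (p - q) := by
    simp only [map_sub]
    ring
  rw [hval] at hsub
  have hterm : ∀ k, aFun A B (res A lam ((bres A B lam)^[k] (p - q))) =
      aFun A B (res A lam ((bres A B lam)^[k] p)) -
        aFun A B (res A lam ((bres A B lam)^[k] q)) := by
    intro k
    rw [h.iterate_bres_sub hV hlam, h.aFun_res hlam, h.aFun_res hlam, h.aFun_res hlam,
      h.bres_sub hV hlam]
    simp only [map_sub]
    ring
  simpa only [hterm] using hsub

theorem aBar_eq (h : KatoConditions A B) (hV : IsKatoSemigroup A B V) (hlam : 0 < lam)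
    {c : X →L[ℝ] ℝ}
    (hc : ∀ u, Tendsto (fun n => Psi ((bres A B lam)^[n] u)) atTop (𝓝 (c u)))
    (x : V.generator.domain) :
    aBar A B V.generator lam x =
      -Psi (V.generator x) - c (lam • (x : X) - V.generator x) := by
  rw [aBar, (h.hasSum_aFun hV hlam hc _).tsum_eq,
    (hV.substochastic.isResolvent_res hlam).1.2 x, map_sub, map_smul, smul_eq_mul]
  ring

/-- A Kato semigroup is honest iff `(B R(lam, A))ⁿ` tends to zero strongly on the positive cone,
for all `lam > 0`. -/
theorem isHonest_iff (h : KatoConditions A B) (hV : IsKatoSemigroup A B V) :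
    IsHonest A B V ↔ ∀ lam : ℝ, 0 < lam → ∀ u : X, 0 ≤ u →
      Tendsto (fun n => ‖(bres A B lam)^[n] u‖) atTop (𝓝 0) := by
  obtain ⟨M, hM⟩ := hV.substochastic.exists_bound
  refine forall₂_congr fun lam hlam => ?_
  obtain ⟨c, hc⟩ := h.exists_defect hV hlam
  have hnorm : ∀ u, 0 ≤ u → Tendsto (fun n => ‖(bres A B lam)^[n] u‖) atTop (𝓝 (c u)) :=
    fun u hu => (hc u).congr fun n => Psi_of_nonneg (h.iterate_bres_nonneg hlam hu n)
  -- The honesty identity at `t`, `u` holds exactly when the `c` term here vanishes.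
  have hbar : ∀ (t : ℝ≥0) (u : X), 0 ≤ u →
      ∀ hm : (∫ s in (0 : ℝ)..t, V.toFun s.toNNReal u) ∈ V.generator.domain,
      -aBar A B V.generator lam ⟨_, hm⟩ = ‖V.toFun t u‖ - ‖u‖ +
        c (lam • (∫ s in (0 : ℝ)..t, V.toFun s.toNNReal u) - (V.toFun t u - u)) := by
    intro t u hu hm
    obtain ⟨_, hval⟩ := CZeroSemigroup.integral_orbit_mem_domain hM u t
    rw [h.aBar_eq hV hlam hc, hval, map_sub Psi, Psi_of_nonneg hu,
      Psi_of_nonneg (hV.substochastic t u hu).1]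
    ring
  constructor
  · intro hh u hu
    have hzero : ∀ (t : ℝ≥0) (x : X),
        c (lam • (∫ s in (0 : ℝ)..t, V.toFun s.toNNReal x) - (V.toFun t x - x)) = 0 := by
      intro t x
      have hpos : ∀ u, 0 ≤ u →
          c (lam • (∫ s in (0 : ℝ)..t, V.toFun s.toNNReal u) - (V.toFun t u - u)) = 0 := by
        intro u hu
        obtain ⟨hm, h1⟩ := hh t u hu
        rw [hbar t u hu hm] at h1
        linarith
      obtain ⟨p, q, hp, hq, rfl⟩ := AbstractStateSpace.generating x
      have h1 : (∫ s in (0 : ℝ)..t, V.toFun s.toNNReal (p - q)) =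
          (∫ s in (0 : ℝ)..t, V.toFun s.toNNReal p) -
            ∫ s in (0 : ℝ)..t, V.toFun s.toNNReal q := by
        simp only [map_sub]
        exact intervalIntegral.integral_sub
          ((CZeroSemigroup.continuous_orbit_toNNReal hM p).intervalIntegrable _ _)
          ((CZeroSemigroup.continuous_orbit_toNNReal hM q).intervalIntegrable _ _)
      have h2 := congrArg₂ (· - ·) (hpos p hp) (hpos q hq)
      simp only [← map_sub, sub_zero] at h2
      rw [h1, map_sub (V.toFun t)]
      refine Eq.trans ?_ h2
      congr 1
      module
    -- With `u = (lam - G) x`, the averages `t⁻¹ ∫₀ᵗ V(s) x ds` and the difference quotients of the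
    -- orbit of `x` exhibit `c u` as a limit of zeros.
    obtain ⟨hm, hres⟩ := (hV.substochastic.isResolvent_res hlam).1.1 u
    set x := res V.generator lam u
    have hgen := V.hasGenerator_generator ⟨x, hm⟩
    have hint : Tendsto
        (fun t : ℝ≥0 => (t : ℝ)⁻¹ • ∫ s in (0 : ℝ)..t, V.toFun s.toNNReal x)
        (𝓝[>] 0) (𝓝 x) := by
      have h1 := (CZeroSemigroup.hasDerivAt_integral_orbit_zero hM x).tendsto_slope_zero_right
      simp only [zero_add, intervalIntegral.integral_same, sub_zero] at h1
      exact h1.comp CZeroSemigroup.tendsto_coe_nhdsGT_zero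
    have hlim := (c.continuous.tendsto _).comp ((hint.const_smul lam).sub hgen)
    rw [hres] at hlim
    have hcu : c u = 0 := by
      have : (𝓝[>] (0 : ℝ≥0)).NeBot := inferInstance
      refine tendsto_nhds_unique hlim (tendsto_const_nhds.congr fun t => ?_)
      rw [Function.comp_apply, smul_comm, ← smul_sub, map_smul, hzero, smul_zero]
    rw [← hcu]
    exact hnorm u hu
  · intro hh t u hu
    have hc0 : ∀ x, c x = 0 := by
      intro x
      obtain ⟨p, q, hp, hq, rfl⟩ := AbstractStateSpace.generating x
      rw [map_sub, tendsto_nhds_unique (hnorm p hp) (hh p hp),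
        tendsto_nhds_unique (hnorm q hq) (hh q hq), sub_zero]
    obtain ⟨hm, -⟩ := CZeroSemigroup.integral_orbit_mem_domain hM u t
    exact ⟨hm, by rw [hbar t u hu hm, hc0, add_zero]⟩

theorem bres_eq_of_sub_eq (h : KatoConditions A B) (hlam : 0 < lam) {v f : X}
    (hv : v ∈ A.domain) (hf : lam • v - A ⟨v, hv⟩ = f) :
    bres A B lam f = B ⟨v, h.domain_le hv⟩ := by
  have h1 : res A lam f = v := hf ▸ (h.isResolvent_res hlam).2 ⟨v, hv⟩
  simp only [h.bres_eq hlam, h1]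

/-- Domination: passing from `A` to an extension of `A - K`, with `K` positive and with a
graph-dense common positive domain, decreases `B R(lam, A)`. -/
theorem bres_le_bres_of_sub_le {K A_K : X →ₗ.[ℝ] X} {V_K : CZeroSemigroup X}
    (h : KatoConditions A B) (hV : IsKatoSemigroup A B V) (hK : IsPositiveOp K)
    (hext : A - K ≤ A_K) (h' : KatoConditions A_K B) (hV' : IsKatoSemigroup A_K B V_K)
    (hdense : PositiveGraphDense A K) (hlam : 0 < lam) {u : X} (hu : 0 ≤ u) :
    bres A_K B lam u ≤ bres A B lam u := by
  have hA := h.res_mem hlam u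
  -- Graph-norm approximants `v n` give `f n = (lam - A) (v n) → u`. The `f n` need not be positive;
  -- only `v n` and `K (v n)` are.
  choose v hvK hv0 hv using fun n : ℕ =>
    hdense ⟨res A lam u, hA⟩ (h.res_nonneg hlam hu) _ (Nat.one_div_pos_of_nat (α := ℝ) (n := n))
  have hlim0 := tendsto_one_div_add_atTop_nhds_zero_nat (𝕜 := ℝ)
  have hv1 : Tendsto (fun n => (v n : X)) atTop (𝓝 (res A lam u)) := by
    refine tendsto_iff_norm_sub_tendsto_zero.mpr
      (squeeze_zero (fun _ => norm_nonneg _) (fun n => ?_) hlim0)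
    rw [norm_sub_rev]
    exact ((le_add_of_nonneg_right (norm_nonneg _)).trans_lt (hv n)).le
  have hv2 : Tendsto (fun n => A (v n)) atTop (𝓝 (A ⟨_, hA⟩)) := by
    refine tendsto_iff_norm_sub_tendsto_zero.mpr
      (squeeze_zero (fun _ => norm_nonneg _) (fun n => ?_) hlim0)
    rw [norm_sub_rev]
    exact ((le_add_of_nonneg_left (norm_nonneg _)).trans_lt (hv n)).le
  have hf : Tendsto (fun n => lam • (v n : X) - A (v n)) atTop (𝓝 u) := by
    have := (hv1.const_smul lam).sub hv2
    rwa [h.apply_res hlam, sub_sub_cancel] at this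
  obtain ⟨P, hP⟩ := h.exists_bres_eq hV hlam
  obtain ⟨Q, hQ⟩ := h'.exists_bres_eq hV' hlam
  rw [← hP, ← hQ]
  refine le_of_tendsto_of_tendsto' ((Q.continuous.tendsto _).comp hf)
    ((P.continuous.tendsto _).comp hf) fun n => ?_
  have hmem : (v n : X) ∈ A_K.domain := hext.1 ⟨(v n).2, hvK n⟩
  have hval : A_K ⟨v n, hmem⟩ = A (v n) - K ⟨v n, hvK n⟩ :=
    (hext.2 (x := ⟨v n, (v n).2, hvK n⟩) (y := ⟨v n, hmem⟩) rfl).symm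
  have h1 : P (lam • (v n : X) - A (v n)) = B ⟨v n, h.domain_le (v n).2⟩ := by
    rw [hP]; exact h.bres_eq_of_sub_eq hlam (v n).2 rfl
  -- `(lam - A_K) (v n) = f n + K (v n)`, so `P (f n) = B (v n) = Q (f n) + Q (K (v n)) ≥ Q (f n)`;
  -- boundedness of `P` and `Q` lets this pass to the limit.
  have h2 : Q (lam • (v n : X) - A (v n) + K ⟨v n, hvK n⟩) = B ⟨v n, h.domain_le (v n).2⟩ := by
    rw [hQ]
    refine h'.bres_eq_of_sub_eq hlam hmem ?_
    rw [hval]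
    abel
  have h3 : 0 ≤ Q (K ⟨v n, hvK n⟩) := by
    rw [hQ]; exact h'.bres_nonneg hlam (hK _ (hv0 n))
  simp only [Function.comp_apply]
  rw [h1, ← h2, map_add]
  exact le_add_of_nonneg_right h3

theorem bres_mono (h : KatoConditions A B) (hV : IsKatoSemigroup A B V) (hlam : 0 < lam)
    {u v : X} (huv : u ≤ v) : bres A B lam u ≤ bres A B lam v := by
  have h1 := h.bres_nonneg hlam (sub_nonneg.mpr huv)
  rwa [h.bres_sub hV hlam, sub_nonneg] at h1

end KatoConditions

end Kato

end KatoPerturbation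

/-! ### Honesty under absorption. -/

theorem mainTheorem11 {X : Type*} [NormedAddCommGroup X] [NormedSpace ℝ X] [CompleteSpace X]
    [PartialOrder X] [IsOrderedAddMonoid X] [IsOrderedModule ℝ X] [OrderClosedTopology X]
    [KatoPerturbation.AbstractStateSpace X]
    (A B K A_K : X →ₗ.[ℝ] X) (V V_K : KatoPerturbation.CZeroSemigroup X)
    (hAB : KatoPerturbation.KatoConditions A B)
    (hV : KatoPerturbation.IsKatoSemigroup A B V)
    (hhonest : KatoPerturbation.IsHonest A B V)
    (hK : KatoPerturbation.IsPositiveOp K)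
    (hext : A - K ≤ A_K)
    (hAKB : KatoPerturbation.KatoConditions A_K B)
    (hVK : KatoPerturbation.IsKatoSemigroup A_K B V_K)
    (hdense : KatoPerturbation.PositiveGraphDense A K) :
    KatoPerturbation.IsHonest A_K B V_K := by
  rw [hAB.isHonest_iff hV] at hhonest
  rw [hAKB.isHonest_iff hVK]
  intro lam hlam u hu
  refine squeeze_zero (fun _ => norm_nonneg _) (fun n => ?_) (hhonest lam hlam u hu)
  refine KatoPerturbation.norm_mono_of_nonneg (hAKB.iterate_bres_nonneg hlam hu n) ?_
  induction n with
  | zero => exact le_rfl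
  | succ n ih =>
    rw [Function.iterate_succ_apply', Function.iterate_succ_apply']
    -- `Q (Qⁿ u) ≤ P (Qⁿ u) ≤ P (Pⁿ u)`: domination at the positive vector `Qⁿ u`, then monotonicity
    -- of `P`.
    exact (hAB.bres_le_bres_of_sub_le hV hK hext hAKB hVK hdense hlam
      (hAKB.iterate_bres_nonneg hlam hu n)).trans (hAB.bres_mono hV hlam ih)
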